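/- For integers $r\ge 1$, $k_1\ge 2$ and $k_2,\dots,k_r\ge 1$, let $$\zeta(k_1,\dots,k_r)=\sum_{n_1>\cdots>n_r>0}\frac{1}{n_1^{k_1}\cdots n_r^{k_r}},\qquad T(k_1,\dots,k_r)=\sum_{\substack{n_1>\cdots>n_r>0\\ n_j\equiv r+1-j\ (\mathrm{mod}\ 2)}}\frac{2^r}{n_1^{k_1}\cdots n_r^{k_r}}$$ denote the multiple zeta values and the multiple $T$-values (the sums run over integers $n_1,\dots,n_r$). Then, for all integers $q\ge 1$ and $p\ge 2$, $$(1-(-1)^q)\sum_{\substack{i+j=p-1\\ i,j\ge 0}}\binom{p+i-1}{i}\binom{q+j-1}{j}\zeta(p+i,q+j)=\sum_{\substack{i+j=q-1\\ i,j\ge 0}}(-1)^j\binom{p+i-1}{i}\binom{p+j-1}{j}\zeta(p+i)\zeta(p+j)$$ and $$(1-(-1)^q)\sum_{\substack{i+j=p-1\\ i,j\ge 0}}\binom{p+i-1}{i}\binom{q+j-1}{j}T(p+i,q+j)=\sum_{\substack{i+j=q-1\\ i,j\ge 0}}(-1)^j\binom{p+i-1}{i}\binom{p+j-1}{j}T(p+i)T(p+j).$$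 In particular, when $q$ is even, the sums on the right-hand sides of both identities vanish. -/

import Mathlib

/-- The indices `n_1 > n_2 > ⋯ > n_r > 0` of a multiple zeta value of depth `r`
(`n_{i+1}` is `n i`, for `i = 0, …, r - 1`). -/
def mzvIndex (r : ℕ) : Set (Fin r → ℕ) :=
  {n | StrictAnti n ∧ ∀ i, 0 < n i}

/-- The indices `n_1 > n_2 > ⋯ > n_r > 0` with `n_j ≡ r + 1 - j (mod 2)` of a multiple `T`-value
of depth `r`; here `j = i + 1`, so that `r + 1 - j = r - i`. -/
def mtvIndex (r : ℕ) : Set (Fin r → ℕ) :=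
  {n | StrictAnti n ∧ (∀ i, 0 < n i) ∧ ∀ i : Fin r, n i ≡ r - (i : ℕ) [MOD 2]}

/-- The multiple zeta value
`ζ(k_1, …, k_r) = ∑_{n_1 > ⋯ > n_r > 0} 1 / (n_1 ^ k_1 ⋯ n_r ^ k_r)`
(a convergent series of positive terms when all `k_i ≥ 1` and `k_1 ≥ 2`). -/
noncomputable def multipleZeta {r : ℕ} (k : Fin r → ℕ) : ℝ :=
  ∑' n : mzvIndex r, 1 / ∏ i, (n.1 i : ℝ) ^ k i

/-- The multiple `T`-value
`T(k_1, …, k_r) = ∑_{n_1 > ⋯ > n_r > 0, n_j ≡ r + 1 - j (mod 2)} 2 ^ r / (n_1 ^ k_1 ⋯ n_r ^ k_r)`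
(a convergent series of positive terms when all `k_i ≥ 1` and `k_1 ≥ 2`). -/
noncomputable def multipleT {r : ℕ} (k : Fin r → ℕ) : ℝ :=
  ∑' n : mtvIndex r, (2 : ℝ) ^ r / ∏ i, (n.1 i : ℝ) ^ k i

/-! Let `u = 1/(x - X)`, `v = 1/(y + X)` and `w = 1/(x + y)`. The denominators of `u` and `v` add up
to the constant `x + y`, so `u * v = w * (u + v)`. This relation alone gives the partial fractions
of `u^p * v^p`, with powers of `w` as coefficients (`pow_mul_pow_eq_partialFractionSum`).

Comparing coefficients of `X^(q-1)` gives `sum_choose_mul_inv_pow`, written with `p`, `q` lowered by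
one. Sum it over all positive integers `x`, `y`, or over all odd ones: the product side splits into
single series, while `n_1 = x + y`, `n_2 = y` runs over the indices of the double series. Exchanging
`x` and `y` merges the two partial fraction sums and produces the factor `1 - (-1)^q`. -/

open Finset in
/-- The sum of the terms in powers of `u` in the partial fraction expansion of
`u ^ (p + 1) * v ^ (q + 1)`. -/
def partialFractionSum {R : Type*} [CommRing R] (w u : R) (p q : ℕ) : R :=
  ∑ x ∈ antidiagonal p, ((q + x.1).choose x.1 : R) * w ^ (q + 1 + x.1) * u ^ (x.2 + 1)

section PartialFractions

variable {R : Type*} [CommRing R] (w u v : R)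

theorem partialFractionSum_zero_left (q : ℕ) : partialFractionSum w u 0 q = w ^ (q + 1) * u := by
  simp [partialFractionSum]

theorem partialFractionSum_succ_zero (p : ℕ) :
    partialFractionSum w u (p + 1) 0 = w * u ^ (p + 2) + w * partialFractionSum w u p 0 := by
  unfold partialFractionSum
  rw [Finset.Nat.sum_antidiagonal_succ, Finset.mul_sum]
  simp only [Nat.zero_add, Nat.choose_self]
  congr 1
  · simp
  · exact Finset.sum_congr rfl fun x _ => by ring

/-- Pascal's rule. It mirrors the recursion of `u^(p+2) * v^(q+2)` under `u * v = w * (u + v)`,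
which drives the double induction. -/
theorem partialFractionSum_succ_succ (p q : ℕ) :
    partialFractionSum w u (p + 1) (q + 1) =
      w * (partialFractionSum w u p (q + 1) + partialFractionSum w u (p + 1) q) := by
  unfold partialFractionSum
  rw [Finset.Nat.sum_antidiagonal_succ, Finset.Nat.sum_antidiagonal_succ, mul_add, mul_add,
    Finset.mul_sum, Finset.mul_sum, add_left_comm, ← Finset.sum_add_distrib]
  congr 1
  · simp; ring
  · refine Finset.sum_congr rfl fun x _ => ?_
    have h : (q + 1 + (x.1 + 1)).choose (x.1 + 1) =
        (q + 1 + x.1).choose x.1 + (q + (x.1 + 1)).choose (x.1 + 1) := by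
      rw [show q + 1 + (x.1 + 1) = (q + 1 + x.1) + 1 by ring, Nat.choose_succ_succ,
        show q + (x.1 + 1) = q + 1 + x.1 by ring]
    rw [h]
    push_cast
    ring

variable {w u v}

theorem mul_pow_eq_partialFractionSum_zero (h : u * v = w * (u + v)) (q : ℕ) :
    u * v ^ (q + 1) = partialFractionSum w u 0 q + partialFractionSum w v q 0 := by
  induction q with
  | zero => simp only [partialFractionSum_zero_left]; linear_combination h
  | succ q ih =>
    rw [partialFractionSum_succ_zero, partialFractionSum_zero_left]
    rw [partialFractionSum_zero_left] at ih
    linear_combination v ^ (q + 1) * h + w * ih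

/-- The partial fraction expansion of `u ^ (p + 1) * v ^ (q + 1)`. -/
theorem pow_mul_pow_eq_partialFractionSum (h : u * v = w * (u + v)) (p q : ℕ) :
    u ^ (p + 1) * v ^ (q + 1) = partialFractionSum w u p q + partialFractionSum w v q p := by
  induction p generalizing q with
  | zero => simpa using mul_pow_eq_partialFractionSum_zero h q
  | succ p ihp =>
    induction q with
    | zero =>
      have h' : v * u = w * (v + u) := by linear_combination h
      linear_combination mul_pow_eq_partialFractionSum_zero h' (p + 1)
    | succ q ihq =>
      rw [partialFractionSum_succ_succ, partialFractionSum_succ_succ]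
      linear_combination u ^ (p + 1) * v ^ (q + 1) * h + w * ihp (q + 1) + w * ihq

end PartialFractions

/-! ### Coefficient extraction in power series -/

section Coefficients

open PowerSeries

/-- The power series `c / (1 - c X)`. -/
noncomputable def geometricSeries (c : ℝ) : ℝ⟦X⟧ :=
  C c * rescale c (mk 1)

theorem coeff_geometricSeries_pow (c : ℝ) (k i : ℕ) :
    coeff i (geometricSeries c ^ (k + 1)) = ((k + i).choose i : ℝ) * c ^ (k + 1 + i) := by
  rw [geometricSeries, mul_pow, ← map_pow, ← map_pow, mk_one_pow_eq_mk_choose_add, coeff_C_mul,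
    coeff_rescale, coeff_mk, Nat.choose_symm_add]
  ring

theorem geometricSeries_inv_mul {x : ℝ} (hx : x ≠ 0) : geometricSeries x⁻¹ * (C x - X) = 1 := by
  have h : rescale x⁻¹ (mk 1 : ℝ⟦X⟧) * (1 - C x⁻¹ * X) = 1 := by
    have := congrArg (rescale x⁻¹) (mk_one_mul_one_sub_eq_one ℝ)
    simpa [rescale_X] using this
  have hC : C x⁻¹ * C x = (1 : ℝ⟦X⟧) := by rw [← map_mul, inv_mul_cancel₀ hx, map_one]
  rw [geometricSeries]
  linear_combination h + rescale x⁻¹ (mk 1 : ℝ⟦X⟧) * hC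

theorem geometricSeries_mul {x y : ℝ} (hx : x ≠ 0) (hy : y ≠ 0) (hxy : x + y ≠ 0) :
    geometricSeries x⁻¹ * -geometricSeries (-y)⁻¹ =
      C (x + y)⁻¹ * (geometricSeries x⁻¹ + -geometricSeries (-y)⁻¹) := by
  have hu := geometricSeries_inv_mul hx
  have hv := geometricSeries_inv_mul (neg_ne_zero.mpr hy)
  have hw : C (x + y)⁻¹ * (C x + C y) = (1 : ℝ⟦X⟧) := by
    rw [← map_add, ← map_mul, inv_mul_cancel₀ hxy, map_one]
  rw [map_neg] at hv
  linear_combination geometricSeries x⁻¹ * geometricSeries (-y)⁻¹ * hw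
    + C (x + y)⁻¹ * geometricSeries x⁻¹ * hv - C (x + y)⁻¹ * geometricSeries (-y)⁻¹ * hu

theorem neg_geometricSeries_pow_coeff (y : ℝ) (k i : ℕ) :
    coeff i ((-geometricSeries (-y)⁻¹) ^ (k + 1)) =
      (-1) ^ i * ((k + i).choose i : ℝ) * y⁻¹ ^ (k + 1 + i) := by
  have h : (-geometricSeries (-y)⁻¹) ^ (k + 1) =
      C ((-1 : ℝ) ^ (k + 1)) * geometricSeries (-y)⁻¹ ^ (k + 1) := by
    rw [neg_pow]; simp
  rw [h, coeff_C_mul, coeff_geometricSeries_pow, inv_neg, neg_pow y⁻¹]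
  have h1 : ((-1 : ℝ) ^ (k + 1)) * (-1) ^ (k + 1 + i) = (-1) ^ i := by
    rw [pow_add _ (k + 1) i, ← mul_assoc, ← mul_pow]; simp
  linear_combination ((k + i).choose i : ℝ) * y⁻¹ ^ (k + 1 + i) * h1

theorem coeff_partialFractionSum (c : ℝ) (g : ℝ⟦X⟧) (p q r : ℕ) :
    coeff r (partialFractionSum (C c) g p q) = ∑ x ∈ Finset.HasAntidiagonal.antidiagonal p,
      ((q + x.1).choose x.1 : ℝ) * c ^ (q + 1 + x.1) * coeff r (g ^ (x.2 + 1)) := by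
  rw [partialFractionSum, map_sum]
  refine Finset.sum_congr rfl fun x _ => ?_
  rw [← coeff_C_mul]
  simp

/-- The partial fraction identity behind the product formula, termwise. -/
theorem sum_choose_mul_inv_pow {x y : ℝ} (hx : x ≠ 0) (hy : y ≠ 0) (hxy : x + y ≠ 0) (p q : ℕ) :
    ∑ i ∈ Finset.HasAntidiagonal.antidiagonal q, (-1 : ℝ) ^ i.2 * ((p + i.1).choose i.1 : ℝ) *
        ((p + i.2).choose i.2 : ℝ) * (x⁻¹ ^ (p + 1 + i.1) * y⁻¹ ^ (p + 1 + i.2)) =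
      ∑ i ∈ Finset.HasAntidiagonal.antidiagonal p, ((p + i.1).choose i.1 : ℝ) *
        ((q + i.2).choose i.2 : ℝ) * ((x + y)⁻¹ ^ (p + 1 + i.1) * x⁻¹ ^ (q + 1 + i.2) +
          (-1) ^ q * ((x + y)⁻¹ ^ (p + 1 + i.1) * y⁻¹ ^ (q + 1 + i.2))) := by
  have h := congrArg (coeff q)
    (pow_mul_pow_eq_partialFractionSum (geometricSeries_mul hx hy hxy) p p)
  rw [map_add, coeff_partialFractionSum, coeff_partialFractionSum, coeff_mul,
    ← Finset.sum_add_distrib] at h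
  simp only [coeff_geometricSeries_pow, neg_geometricSeries_pow_coeff] at h
  convert h using 1
  · exact Finset.sum_congr rfl fun i _ => by ring
  · refine Finset.sum_congr rfl fun i _ => ?_
    -- The `X^q` coefficient carries `choose (i.2 + q) q`.
    rw [Nat.add_comm i.2 q, Nat.choose_symm_add]
    ring

end Coefficients

/-! ### Convergence and summation -/

section Summation

variable {f : ℕ → ℝ}

theorem summable_inv_pow (hf : ∀ a : ℕ, (a : ℝ) + 1 ≤ f a) {k : ℕ} (hk : 2 ≤ k) :
    Summable fun a => (f a)⁻¹ ^ k := by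
  have h := (summable_nat_add_iff 1).2 (Real.summable_nat_pow_inv.2 (show 1 < k by lia))
  have h0 : ∀ a, 0 < f a := fun a => by linarith [hf a, a.cast_nonneg (α := ℝ)]
  refine h.of_nonneg_of_le (fun a => ?_) fun a => ?_
  · have := h0 a; positivity
  · have := h0 a
    have := hf a
    rw [inv_pow]
    push_cast
    gcongr

theorem summable_inv_rpow (hf : ∀ a : ℕ, (a : ℝ) + 1 ≤ f a) :
    Summable fun a => (f a ^ (3 / 2 : ℝ))⁻¹ := by
  have h := (summable_nat_add_iff 1).2
    (Real.summable_nat_rpow_inv.2 (show (1 : ℝ) < 3 / 2 by norm_num))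
  have h0 : ∀ a, 0 < f a := fun a => by linarith [hf a, a.cast_nonneg (α := ℝ)]
  refine h.of_nonneg_of_le (fun a => ?_) fun a => ?_
  · have := h0 a; positivity
  · have := h0 a
    have := hf a
    push_cast
    gcongr

/-- The worst case is `k = 2`, `l = 1`. Splitting `(x + y)^2` with exponents `3/2` and `1/2` leaves
each variable with exponent `3/2 > 1`, so a product of convergent series dominates the double
series. -/
theorem rpow_mul_rpow_le {x y : ℝ} (hx : 1 ≤ x) (hy : 1 ≤ y) {k l : ℕ} (hk : 2 ≤ k) (hl : 1 ≤ l) :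
    x ^ (3 / 2 : ℝ) * y ^ (3 / 2 : ℝ) ≤ (x + y) ^ k * y ^ l := by
  have hx0 : 0 < x := by linarith
  have hy0 : 0 < y := by linarith
  calc x ^ (3 / 2 : ℝ) * y ^ (3 / 2 : ℝ)
      = x ^ (3 / 2 : ℝ) * y ^ (1 / 2 : ℝ) * y := by
        rw [mul_assoc, ← Real.rpow_add_one hy0.ne']; norm_num
    _ ≤ (x + y) ^ (3 / 2 : ℝ) * (x + y) ^ (1 / 2 : ℝ) * y := by
        gcongr <;> linarith
    _ = (x + y) ^ 2 * y ^ 1 := by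
        rw [← Real.rpow_add (by linarith)]; norm_num
    _ ≤ (x + y) ^ k * y ^ l := by
        gcongr
        linarith

theorem summable_inv_add_pow_mul_inv_pow (hf : ∀ a : ℕ, (a : ℝ) + 1 ≤ f a) {k l : ℕ}
    (hk : 2 ≤ k) (hl : 1 ≤ l) :
    Summable fun a : ℕ × ℕ => (f a.1 + f a.2)⁻¹ ^ k * (f a.2)⁻¹ ^ l := by
  have h1 : ∀ a, 1 ≤ f a := fun a => by have := hf a; linarith [a.cast_nonneg (α := ℝ)]
  have h0 : ∀ a, 0 < f a := fun a => one_pos.trans_le (h1 a)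
  refine ((summable_inv_rpow hf).mul_of_nonneg (summable_inv_rpow hf)
    (fun a => ?_) (fun a => ?_)).of_nonneg_of_le (fun a => ?_) fun a => ?_
  · have := h0 a; positivity
  · have := h0 a; positivity
  · have := h0 a.1; have := h0 a.2; positivity
  · have := h0 a.1; have := h0 a.2
    rw [inv_pow, inv_pow, ← mul_inv, ← mul_inv]
    exact inv_anti₀ (by positivity) (rpow_mul_rpow_le (h1 _) (h1 _) hk hl)

theorem hasSum_prod_mul_of_nonneg {g h : ℕ → ℝ} (hg : Summable g) (hh : Summable h)
    (hg0 : ∀ a, 0 ≤ g a) (hh0 : ∀ a, 0 ≤ h a) :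
    HasSum (fun a : ℕ × ℕ => g a.1 * h a.2) ((∑' a, g a) * ∑' a, h a) :=
  hg.hasSum.mul hh.hasSum (hg.mul_of_nonneg hh hg0 hh0)

/-- The identity between products of single series over the values of `f` and double series. -/
theorem sum_tsum_inv_pow_mul_tsum_inv_pow (hf : ∀ a : ℕ, (a : ℝ) + 1 ≤ f a) {p : ℕ} (hp : 1 ≤ p)
    (q : ℕ) :
    (1 + (-1 : ℝ) ^ q) * ∑ i ∈ Finset.HasAntidiagonal.antidiagonal p,
        ((p + i.1).choose i.1 : ℝ) * ((q + i.2).choose i.2 : ℝ) *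
          ∑' a : ℕ × ℕ, (f a.1 + f a.2)⁻¹ ^ (p + 1 + i.1) * (f a.2)⁻¹ ^ (q + 1 + i.2) =
      ∑ i ∈ Finset.HasAntidiagonal.antidiagonal q, (-1 : ℝ) ^ i.2 *
        ((p + i.1).choose i.1 : ℝ) * ((p + i.2).choose i.2 : ℝ) *
          ((∑' a, (f a)⁻¹ ^ (p + 1 + i.1)) * ∑' a, (f a)⁻¹ ^ (p + 1 + i.2)) := by
  have h0 : ∀ a, 0 < f a := fun a => by have := hf a; linarith [a.cast_nonneg (α := ℝ)]
  have hD (i : ℕ × ℕ) := (summable_inv_add_pow_mul_inv_pow hf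
    (show 2 ≤ p + 1 + i.1 by lia) (show 1 ≤ q + 1 + i.2 by lia)).hasSum
  -- Exchanging the variables gives both halves of the partial fractions the same sum, hence the
  -- factor `1 + (-1)^q`.
  have hD' (i : ℕ × ℕ) : HasSum
      (fun a : ℕ × ℕ => (f a.1 + f a.2)⁻¹ ^ (p + 1 + i.1) * (f a.1)⁻¹ ^ (q + 1 + i.2))
      (∑' a : ℕ × ℕ, (f a.1 + f a.2)⁻¹ ^ (p + 1 + i.1) * (f a.2)⁻¹ ^ (q + 1 + i.2)) := by
    rw [← (Equiv.prodComm ℕ ℕ).hasSum_iff]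
    simpa [Function.comp_def, add_comm] using hD i
  have hN (k : ℕ) (a : ℕ) : 0 ≤ (f a)⁻¹ ^ k :=
    pow_nonneg (inv_nonneg.2 (h0 a).le) k
  have hS (i : ℕ) := summable_inv_pow hf (show 2 ≤ p + 1 + i by lia)
  have hP (i : ℕ × ℕ) : HasSum
      (fun a : ℕ × ℕ => (f a.1)⁻¹ ^ (p + 1 + i.1) * (f a.2)⁻¹ ^ (p + 1 + i.2))
      ((∑' a, (f a)⁻¹ ^ (p + 1 + i.1)) * ∑' a, (f a)⁻¹ ^ (p + 1 + i.2)) :=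
    hasSum_prod_mul_of_nonneg (hS i.1) (hS i.2) (hN (p + 1 + i.1)) (hN (p + 1 + i.2))
  have hL := hasSum_sum (s := Finset.HasAntidiagonal.antidiagonal q) fun i _ =>
    (hP i).mul_left ((-1 : ℝ) ^ i.2 * ((p + i.1).choose i.1 : ℝ) * ((p + i.2).choose i.2 : ℝ))
  have hR := hasSum_sum (s := Finset.HasAntidiagonal.antidiagonal p) fun i _ =>
    ((hD' i).add ((hD i).mul_left ((-1 : ℝ) ^ q))).mul_left
      (((p + i.1).choose i.1 : ℝ) * ((q + i.2).choose i.2 : ℝ))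
  have hE (a : ℕ × ℕ) := sum_choose_mul_inv_pow (h0 a.1).ne' (h0 a.2).ne'
    (add_pos (h0 a.1) (h0 a.2)).ne' p q
  rw [← hL.tsum_eq, tsum_congr hE, hR.tsum_eq, Finset.mul_sum]
  exact Finset.sum_congr rfl fun i _ => by ring

end Summation

/-! ### Zeta and `T`-values as series over free indices -/

section Reindexing

theorem multipleZeta_one_eq_tsum (k : ℕ) :
    multipleZeta ![k] = ∑' a : ℕ, ((a : ℝ) + 1)⁻¹ ^ k := by
  let g : ℕ → mzvIndex 1 := fun a =>
    ⟨![a + 1], Subsingleton.strictAnti _, fun i => by fin_cases i; simp⟩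
  have hg : Function.Bijective g := by
    refine ⟨fun a b h => ?_, fun n => ⟨n.1 0 - 1, Subtype.ext (funext fun i => ?_)⟩⟩
    · simpa [g] using congrFun (congrArg Subtype.val h) 0
    · have := n.2.2 0
      fin_cases i
      simp [g]; lia
  rw [multipleZeta, ← (Equiv.ofBijective g hg).tsum_eq]
  exact tsum_congr fun a => by simp [g]

theorem multipleT_one_eq_tsum (k : ℕ) :
    multipleT ![k] = 2 * ∑' a : ℕ, (2 * (a : ℝ) + 1)⁻¹ ^ k := by
  let g : ℕ → mtvIndex 1 := fun a =>
    ⟨![2 * a + 1], Subsingleton.strictAnti _, fun i => by fin_cases i; simp,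
      fun i => by fin_cases i; simp [Nat.ModEq]⟩
  have hg : Function.Bijective g := by
    refine ⟨fun a b h => ?_, fun n => ⟨n.1 0 / 2, Subtype.ext (funext fun i => ?_)⟩⟩
    · simpa [g] using congrFun (congrArg Subtype.val h) 0
    · have := n.2.2.2 0
      simp only [Nat.ModEq] at this
      fin_cases i
      simp [g] at this ⊢; lia
  rw [multipleT, ← (Equiv.ofBijective g hg).tsum_eq, ← tsum_mul_left]
  exact tsum_congr fun a => by simp [g, div_eq_mul_inv]

theorem multipleZeta_two_eq_tsum (k l : ℕ) :
    multipleZeta ![k, l] = ∑' a : ℕ × ℕ,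
      (((a.1 : ℝ) + 1) + ((a.2 : ℝ) + 1))⁻¹ ^ k * ((a.2 : ℝ) + 1)⁻¹ ^ l := by
  let g : ℕ × ℕ → mzvIndex 2 := fun a =>
    ⟨![(a.1 + 1) + (a.2 + 1), a.2 + 1], by
      rw [Fin.strictAnti_iff_succ_lt]; intro i; fin_cases i; simp,
      fun i => by fin_cases i <;> simp⟩
  have hg : Function.Bijective g := by
    refine ⟨fun a b h => ?_, fun n => ⟨(n.1 0 - n.1 1 - 1, n.1 1 - 1),
      Subtype.ext (funext fun i => ?_)⟩⟩
    · have h1 := congrFun (congrArg Subtype.val h) 0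
      have h2 := congrFun (congrArg Subtype.val h) 1
      simp [g] at h1 h2
      ext <;> lia
    · have h1 := n.2.1 (show (0 : Fin 2) < 1 by decide)
      have h2 := n.2.2 1
      fin_cases i <;> simp [g] <;> lia
  rw [multipleZeta, ← (Equiv.ofBijective g hg).tsum_eq]
  exact tsum_congr fun a => by simp [g, mul_comm]

theorem multipleT_two_eq_tsum (k l : ℕ) :
    multipleT ![k, l] = 4 * ∑' a : ℕ × ℕ,
      ((2 * (a.1 : ℝ) + 1) + (2 * (a.2 : ℝ) + 1))⁻¹ ^ k * (2 * (a.2 : ℝ) + 1)⁻¹ ^ l := by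
  let g : ℕ × ℕ → mtvIndex 2 := fun a =>
    ⟨![(2 * a.1 + 1) + (2 * a.2 + 1), 2 * a.2 + 1], by
      rw [Fin.strictAnti_iff_succ_lt]; intro i; fin_cases i; simp,
      fun i => by fin_cases i <;> simp,
      fun i => by fin_cases i <;> simp [Nat.ModEq]; lia⟩
  have hg : Function.Bijective g := by
    -- Here `n_1` is even and `n_2` odd, so `n_1 - n_2` is odd and floor halving inverts `a ↦ 2 * a
    -- + 1`.
    refine ⟨fun a b h => ?_, fun n => ⟨((n.1 0 - n.1 1) / 2, n.1 1 / 2),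
      Subtype.ext (funext fun i => ?_)⟩⟩
    · have h1 := congrFun (congrArg Subtype.val h) 0
      have h2 := congrFun (congrArg Subtype.val h) 1
      simp [g] at h1 h2
      ext <;> lia
    · have h1 := n.2.1 (show (0 : Fin 2) < 1 by decide)
      have h2 := n.2.2.2 0
      have h3 := n.2.2.2 1
      simp [Nat.ModEq] at h2 h3
      fin_cases i <;> simp [g] <;> lia
  rw [multipleT, ← (Equiv.ofBijective g hg).tsum_eq, ← tsum_mul_left]
  refine tsum_congr fun a => ?_
  simp [g, div_eq_mul_inv]
  ring

end Reindexing

theorem multipleZeta_product_formula {p : ℕ} (hp : 1 ≤ p) (q : ℕ) :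
    (1 + (-1 : ℝ) ^ q) * ∑ x ∈ Finset.HasAntidiagonal.antidiagonal p,
        ((p + x.1).choose x.1 : ℝ) * ((q + x.2).choose x.2 : ℝ) *
          multipleZeta ![p + 1 + x.1, q + 1 + x.2] =
      ∑ x ∈ Finset.HasAntidiagonal.antidiagonal q, (-1 : ℝ) ^ x.2 *
        ((p + x.1).choose x.1 : ℝ) * ((p + x.2).choose x.2 : ℝ) *
          (multipleZeta ![p + 1 + x.1] * multipleZeta ![p + 1 + x.2]) := by
  simp only [multipleZeta_one_eq_tsum, multipleZeta_two_eq_tsum]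
  exact sum_tsum_inv_pow_mul_tsum_inv_pow (f := fun a => (a : ℝ) + 1) (fun _ => le_rfl) hp q

theorem multipleT_product_formula {p : ℕ} (hp : 1 ≤ p) (q : ℕ) :
    (1 + (-1 : ℝ) ^ q) * ∑ x ∈ Finset.HasAntidiagonal.antidiagonal p,
        ((p + x.1).choose x.1 : ℝ) * ((q + x.2).choose x.2 : ℝ) *
          multipleT ![p + 1 + x.1, q + 1 + x.2] =
      ∑ x ∈ Finset.HasAntidiagonal.antidiagonal q, (-1 : ℝ) ^ x.2 *
        ((p + x.1).choose x.1 : ℝ) * ((p + x.2).choose x.2 : ℝ) *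
          (multipleT ![p + 1 + x.1] * multipleT ![p + 1 + x.2]) := by
  have h := sum_tsum_inv_pow_mul_tsum_inv_pow (f := fun a => 2 * (a : ℝ) + 1)
    (fun a => by linarith [a.cast_nonneg (α := ℝ)]) hp q
  -- Both sides carry the same factor: `2^2` in depth two, `2 * 2` from the product.
  simp only [multipleT_one_eq_tsum, multipleT_two_eq_tsum, mul_left_comm _ (4 : ℝ),
    mul_mul_mul_comm (2 : ℝ), ← Finset.mul_sum, h]
  rw [Finset.mul_sum]
  exact Finset.sum_congr rfl fun x _ => by ring

theorem mainTheorem6 (p q : ℕ) (hp : 2 ≤ p) (hq : 1 ≤ q) :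
    ((1 - (-1 : ℝ) ^ q) *
        ∑ x ∈ Finset.HasAntidiagonal.antidiagonal (p - 1),
          (Nat.choose (p + x.1 - 1) x.1 : ℝ) * (Nat.choose (q + x.2 - 1) x.2 : ℝ) *
            multipleZeta ![p + x.1, q + x.2]
      = ∑ x ∈ Finset.HasAntidiagonal.antidiagonal (q - 1),
          (-1 : ℝ) ^ x.2 * (Nat.choose (p + x.1 - 1) x.1 : ℝ) *
            (Nat.choose (p + x.2 - 1) x.2 : ℝ) *
            (multipleZeta ![p + x.1] * multipleZeta ![p + x.2])) ∧
    ((1 - (-1 : ℝ) ^ q) *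
        ∑ x ∈ Finset.HasAntidiagonal.antidiagonal (p - 1),
          (Nat.choose (p + x.1 - 1) x.1 : ℝ) * (Nat.choose (q + x.2 - 1) x.2 : ℝ) *
            multipleT ![p + x.1, q + x.2]
      = ∑ x ∈ Finset.HasAntidiagonal.antidiagonal (q - 1),
          (-1 : ℝ) ^ x.2 * (Nat.choose (p + x.1 - 1) x.1 : ℝ) *
            (Nat.choose (p + x.2 - 1) x.2 : ℝ) *
            (multipleT ![p + x.1] * multipleT ![p + x.2])) ∧
    (Even q →
      (∑ x ∈ Finset.HasAntidiagonal.antidiagonal (q - 1),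
          (-1 : ℝ) ^ x.2 * (Nat.choose (p + x.1 - 1) x.1 : ℝ) *
            (Nat.choose (p + x.2 - 1) x.2 : ℝ) *
            (multipleZeta ![p + x.1] * multipleZeta ![p + x.2]) = 0) ∧
      (∑ x ∈ Finset.HasAntidiagonal.antidiagonal (q - 1),
          (-1 : ℝ) ^ x.2 * (Nat.choose (p + x.1 - 1) x.1 : ℝ) *
            (Nat.choose (p + x.2 - 1) x.2 : ℝ) *
            (multipleT ![p + x.1] * multipleT ![p + x.2]) = 0)) := by
  obtain ⟨p, rfl⟩ : ∃ n, p = n + 1 := ⟨p - 1, by lia⟩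
  obtain ⟨q, rfl⟩ : ∃ n, q = n + 1 := ⟨q - 1, by lia⟩
  have hZ := multipleZeta_product_formula (show 1 ≤ p by lia) q
  have hT := multipleT_product_formula (show 1 ≤ p by lia) q
  have hs : 1 - (-1 : ℝ) ^ (q + 1) = 1 + (-1) ^ q := by ring
  have hc (n i : ℕ) : n + 1 + i - 1 = n + i := by lia
  simp only [hs, hc, Nat.add_sub_cancel]
  refine ⟨hZ, hT, fun hev => ?_⟩
  have h0 : 1 + (-1 : ℝ) ^ q = 0 := by rw [← hs, hev.neg_one_pow, sub_self]
  rw [h0, zero_mul] at hZ hT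
  exact ⟨hZ.symm, hT.symm⟩
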